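/- Let $\mathbf X=(X_t:t\in\mathbb R)$ be a centered stationary real Gaussian process with (almost surely) continuous sample paths, and let $R(s,t)=\mathrm E(X_sX_t)$ be its covariance function. Let $F_X$ be its spectral measure, i.e. the finite symmetric Borel measure on $\mathbb R$ such that $$R(s,t)=\int_{\mathbb R}e^{i(t-s)x}\,F_X(dx),\qquad s,t\in\mathbb R.$$ Assume that S1. $\int_{\mathbb R}e^{tx}\,F_X(dx)<\infty$ for all $t\in\mathbb R$; S2. the support of $F_X$ has at least one accumulation point. Then the following hold. Property 1. There are real numbers $(r_{mn})_{m,n\ge0}$ such that, for all $s,t\in\mathbb R$, $$R(s,t)=\sum_{m=0}^\infty\sum_{n=0}^\infty r_{mn}s^mt^n,$$ where the double series converges absolutely. Property 2. For any compact interval $[a,b]$, $a\le b$, the family $(X_t:t\in[a,b])$ is non-negatively non-degenerate: for any Borel probability measure $\nu$ on $[a,b]$, the integral $\int_a^bX_t\,\nu(dt)$ is an almost surely well-defined, square-integrable random variable, and $$\mathrm{Var}\left(\int_a^bX_t\,\nu(dt)\right)=\int_a^b\int_a^bR(s,t)\,\nu(ds)\,\nu(dt)>0.$$ Property 3. Almost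 surely, the sample path $t\mapsto X_t$ is infinitely differentiable on $\mathbb R$. Writing $X^{(n)}_t$ for its $n$-th derivative at $t$ (with $X^{(0)}_t=X_t$), every $X^{(n)}_t$ is square-integrable, and for every finite set of distinct pairs $(t_1,n_1),\dots,(t_k,n_k)\in\mathbb R\times\{0,1,2,\dots\}$ the covariance matrix of $(X^{(n_1)}_{t_1},\dots,X^{(n_k)}_{t_k})$ is non-singular. -/

import Mathlib

open MeasureTheory ProbabilityTheory Set Filter Topology

noncomputable section

namespace GaussianMinima

variable {Ω : Type*} [MeasurableSpace Ω]

/-- A real process indexed by `ℝ` is (strictly) stationary: its finite-dimensional distributions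
are invariant under time shifts. -/
def IsStationary (X : ℝ → Ω → ℝ) (P : Measure Ω) : Prop :=
  ∀ (h : ℝ) (I : Finset ℝ),
    IdentDistrib (fun ω => I.restrict (fun t => X (t + h) ω))
      (fun ω => I.restrict (fun t => X t ω)) P P

/-- `R(s,t) = E(X_s X_t)`. -/
def covFun (X : ℝ → Ω → ℝ) (P : Measure Ω) (s t : ℝ) : ℝ :=
  ∫ ω, X s ω * X t ω ∂P

/-- `F` is the spectral measure of the process: a finite symmetric Borel measure with
`R(s,t) = ∫ exp(i (t-s) x) F(dx)`. -/
structure IsSpectralMeasure (X : ℝ → Ω → ℝ) (P : Measure Ω) (F : Measure ℝ) : Prop where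
  finite : IsFiniteMeasure F
  symm : F.map (fun x => -x) = F
  covFun_eq : ∀ s t : ℝ,
    (covFun X P s t : ℂ) = ∫ x : ℝ, Complex.exp (Complex.I * ((t - s : ℝ) : ℂ) * (x : ℂ)) ∂F

/-- Condition S1: all exponential moments are finite. -/
def HasExpMoments (F : Measure ℝ) : Prop :=
  ∀ t : ℝ, Integrable (fun x : ℝ => Real.exp (t * x)) F

/-- Condition S2: the (closed) support has an accumulation point. -/
def SupportHasAccPt (F : Measure ℝ) : Prop :=
  ∃ x : ℝ, AccPt x (𝓟 F.support)

/-- The function of two variables has a double power series expansion, (absolutely) convergent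
on the whole plane. -/
def HasPowerExpansion (R : ℝ → ℝ → ℝ) : Prop :=
  ∃ r : ℕ → ℕ → ℝ, ∀ s t : ℝ,
    HasSum (fun p : ℕ × ℕ => r p.1 p.2 * s ^ p.1 * t ^ p.2) (R s t)

/-- The family `(X_t : t ∈ [a,b])` is non-negatively non-degenerate: for every probability measure
`ν` on `[a,b]`, the integral `∫ X_t ν(dt)` is a well-defined square-integrable random variable with
`Var (∫ X_t ν(dt)) = ∫∫ R(s,t) ν(ds) ν(dt) > 0`. -/
def NonnegNondegenerateOn (X : ℝ → Ω → ℝ) (P : Measure Ω) (a b : ℝ) : Prop :=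
  ∀ ν : Measure ℝ, IsProbabilityMeasure ν → ν (Icc a b) = 1 →
    (∀ᵐ ω ∂P, IntegrableOn (fun t => X t ω) (Icc a b) ν) ∧
    MemLp (fun ω => ∫ t in Icc a b, X t ω ∂ν) 2 P ∧
    variance (fun ω => ∫ t in Icc a b, X t ω ∂ν) P
      = ∫ t in Icc a b, ∫ s in Icc a b, covFun X P s t ∂ν ∂ν ∧
    0 < variance (fun ω => ∫ t in Icc a b, X t ω ∂ν) P

/-- The derivative `X_t^{(n)}` of the sample paths, for `p = (t, n)`. It has its meaning on the
almost sure event where the path is smooth. -/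
def pathDeriv (X : ℝ → Ω → ℝ) (p : ℝ × ℕ) (ω : Ω) : ℝ :=
  iteratedDeriv p.2 (fun t => X t ω) p.1

/-- Almost every sample path is infinitely differentiable, all the derivatives `X_t^{(n)}` are
square integrable, and the covariance matrix of any finite subfamily of
`(X_t^{(n)} : t ∈ ℝ, n ≥ 0)` is non-singular. -/
def SmoothNondegenerate (X : ℝ → Ω → ℝ) (P : Measure Ω) : Prop :=
  (∀ᵐ ω ∂P, ContDiff ℝ ((⊤ : ℕ∞) : WithTop ℕ∞) (fun t => X t ω)) ∧
  (∀ p : ℝ × ℕ, MemLp (pathDeriv X p) 2 P) ∧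
  ∀ I : Finset (ℝ × ℕ),
    (Matrix.of fun p q : I => covariance (pathDeriv X p) (pathDeriv X q) P).det ≠ 0

end GaussianMinima

end

/-! The process is studied through its spectral model. In `L²(F)` the functions `e^{itx}` have real
Gram matrix `R`, and so do the `X_t` in `L²(P)`; hence `e^{itx} ↦ X_t` extends to a linear isometry
`T` from the closed real span of the exponentials into `L²(P)` (`exists_linearIsometry_of_inner_eq`,
`exists_isometry_specLp`).

S1 makes `e^{itx} = ∑ t^k/k! (ix)^k` converge absolutely in `L²(F)` for every `t`
(`entireCoeff_specLp`). The derivatives `(ix)^n e^{itx}` stay in the closed span, and `T` turns the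
series into one in `L²(P)` that also converges almost surely. A continuous path agrees with its sum
at rational times, hence everywhere, so paths are smooth and `X_t^{(n)} = T((ix)^n e^{itx})` almost
surely. Property 1 comes from integrating the product of two such scalar series against `F`.

S2 enters through the identity theorem: an entire function vanishing `F`-a.e. is zero
(`Differentiable.eq_zero_of_ae_eq_zero`). For combinations of `(iz)^n e^{itz}` this gives Property
3; for the characteristic function `φ` of `ν` it gives Property 2, since the variance is `∫ |φ|²
dF`. -/

/-! ### Exponential series with coefficients in a Banach space -/

section ExpSeries

open Nat

variable {E : Type*} [NormedAddCommGroup E]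

/-- The exponential generating series of `c` converges absolutely on the whole line. -/
def EntireCoeff (c : ℕ → E) : Prop := ∀ r : ℕ, Summable fun n => (r : ℝ) ^ n / n ! * ‖c n‖

lemma EntireCoeff.summable_abs {c : ℕ → E} (hc : EntireCoeff c) (t : ℝ) :
    Summable fun n => |t| ^ n / n ! * ‖c n‖ := by
  obtain ⟨r, hr⟩ := exists_nat_ge |t|
  refine (hc r).of_nonneg_of_le (fun n => by positivity) fun n => ?_
  gcongr

lemma EntireCoeff.succ {c : ℕ → E} (hc : EntireCoeff c) : EntireCoeff fun n => c (n + 1) := by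
  intro r
  -- The shift costs a factor `n + 1 ≤ 2^(n+1)`, absorbed by doubling the radius; `r + 1` has powers
  -- that increase with the exponent even when `r < 1`.
  have h := ((summable_nat_add_iff 1).2 (hc (2 * (r + 1))))
  refine h.of_nonneg_of_le (fun n => by positivity) fun n => ?_
  have h2 : ((n : ℝ) + 1) ≤ 2 ^ (n + 1) := by
    exact_mod_cast (Nat.lt_two_pow_self (n := n + 1)).le
  refine mul_le_mul_of_nonneg_right ?_ (norm_nonneg _)
  rw [div_le_div_iff₀ (by positivity) (by positivity), Nat.factorial_succ]
  push_cast
  have h3 : (r : ℝ) ^ n ≤ ((r : ℝ) + 1) ^ (n + 1) := by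
    calc (r : ℝ) ^ n ≤ ((r : ℝ) + 1) ^ n := by gcongr; linarith
      _ ≤ ((r : ℝ) + 1) ^ (n + 1) := pow_le_pow_right₀ (by linarith [r.cast_nonneg (α := ℝ)]) (by simp)
  rw [mul_pow]
  calc (r : ℝ) ^ n * (((n : ℝ) + 1) * n !) = ((n : ℝ) + 1) * (r : ℝ) ^ n * n ! := by ring
    _ ≤ 2 ^ (n + 1) * ((r : ℝ) + 1) ^ (n + 1) * n ! := by gcongr

lemma EntireCoeff.add_right {c : ℕ → E} (hc : EntireCoeff c) (n : ℕ) :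
    EntireCoeff fun k => c (k + n) := by
  induction n with
  | zero => exact hc
  | succ n ih => simpa [add_assoc, add_comm 1 n] using ih.succ

variable [NormedSpace ℝ E]

/-- The exponential generating series `∑ tⁿ/n! • c n`. -/
noncomputable def expSeries (c : ℕ → E) (t : ℝ) : E := ∑' n, (t ^ n / n !) • c n

lemma EntireCoeff.summable_norm {c : ℕ → E} (hc : EntireCoeff c) (t : ℝ) :
    Summable fun n => ‖(t ^ n / n !) • c n‖ := by
  refine (hc.summable_abs t).congr fun n => ?_
  rw [norm_smul, norm_div, norm_pow, Real.norm_eq_abs, RCLike.norm_natCast]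

lemma hasDerivAt_pow_div_factorial (n : ℕ) (t : ℝ) :
    HasDerivAt (fun t : ℝ => t ^ (n + 1) / (n + 1) !) (t ^ n / n !) t := by
  have h := (hasDerivAt_pow (n + 1) t).div_const ((n + 1) ! : ℝ)
  convert! h using 1
  rw [Nat.factorial_succ]
  push_cast
  field_simp

lemma EntireCoeff.map {F : Type*} [NormedAddCommGroup F] [NormedSpace ℝ F]
    {c : ℕ → E} (hc : EntireCoeff c) (T : E →ₗᵢ[ℝ] F) :
    EntireCoeff (fun n => T (c n)) := fun r => by simpa using hc r

variable [CompleteSpace E]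

lemma EntireCoeff.hasSum {c : ℕ → E} (hc : EntireCoeff c) (t : ℝ) :
    HasSum (fun n => (t ^ n / n !) • c n) (expSeries c t) :=
  (Summable.of_norm (hc.summable_norm t)).hasSum

lemma EntireCoeff.hasDerivAt {c : ℕ → E} (hc : EntireCoeff c) (t : ℝ) :
    HasDerivAt (expSeries c) (expSeries (fun n => c (n + 1)) t) t := by
  obtain ⟨r, hr⟩ := exists_nat_gt |t|
  have hr0 : (0 : ℝ) < r := (abs_nonneg t).trans_lt hr
  -- With the constant term split off, the `n`-th summand differentiates exactly to `t^n/n! • c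
  -- (n+1)`, which is dominated on the ball of radius `r`.
  have h : HasDerivAt (fun z : ℝ => ∑' n, (z ^ (n + 1) / (n + 1)!) • c (n + 1))
      (∑' n, (t ^ n / n !) • c (n + 1)) t := by
    refine hasDerivAt_tsum_of_isPreconnected (hc.succ r) Metric.isOpen_ball
      (convex_ball (0 : ℝ) r).isPreconnected
      (fun n y _ => (hasDerivAt_pow_div_factorial n y).smul_const (c (n + 1))) (fun n y hy => ?_)
      (Metric.mem_ball_self hr0) ?_ (by simpa using hr)
    · rw [norm_smul, norm_div, norm_pow, RCLike.norm_natCast]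
      have : ‖y‖ ≤ r := (mem_ball_zero_iff.1 hy).le
      gcongr
    · exact (summable_nat_add_iff 1).2 (Summable.of_norm (hc.summable_norm 0))
  have h2 := h.const_add (c 0)
  have he : expSeries c = fun z : ℝ => c 0 + ∑' n, (z ^ (n + 1) / (n + 1)!) • c (n + 1) := by
    funext z
    rw [expSeries, (Summable.of_norm (hc.summable_norm z)).tsum_eq_zero_add]
    simp
  rw [he]
  exact h2

lemma EntireCoeff.continuous {c : ℕ → E} (hc : EntireCoeff c) : Continuous (expSeries c) :=
  continuous_iff_continuousAt.2 fun t => (hc.hasDerivAt t).continuousAt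

lemma EntireCoeff.iteratedDeriv {c : ℕ → E} (hc : EntireCoeff c) (n : ℕ) :
    iteratedDeriv n (expSeries c) = expSeries fun k => c (k + n) := by
  induction n with
  | zero => simp
  | succ n ih =>
    rw [iteratedDeriv_succ, ih]
    funext t
    rw [((hc.add_right n).hasDerivAt t).deriv]
    simp [add_assoc, add_comm 1 n]

lemma EntireCoeff.contDiff {c : ℕ → E} (hc : EntireCoeff c) :
    ContDiff ℝ ((⊤ : ℕ∞) : WithTop ℕ∞) (expSeries c) := by
  refine contDiff_of_differentiable_iteratedDeriv fun m _ => ?_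
  rw [hc.iteratedDeriv]
  exact fun t => ((hc.add_right m).hasDerivAt t).differentiableAt

/-- If an exponential series takes its values in a closed subspace, so do its derivatives. -/
lemma EntireCoeff.mem_of_forall_mem {c : ℕ → E} (hc : EntireCoeff c) {K : Submodule ℝ E}
    (hK : IsClosed (K : Set E)) (h : ∀ t, expSeries c t ∈ K) (n : ℕ) (t : ℝ) :
    expSeries (fun k => c (k + n)) t ∈ K := by
  induction n generalizing t with
  | zero => exact h t
  | succ n ih =>
    have hd := ((hc.add_right n).hasDerivAt t).tendsto_slope
    have : expSeries (fun k => c (k + 1 + n)) t ∈ K := by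
      refine hK.mem_of_tendsto hd (Eventually.of_forall fun s => ?_)
      exact K.smul_mem _ (K.sub_mem (ih s) (ih t))
    simpa [add_assoc, add_comm 1 n] using this

lemma EntireCoeff.map_expSeries {F : Type*} [NormedAddCommGroup F] [NormedSpace ℝ F]
    [CompleteSpace F] {c : ℕ → E} (hc : EntireCoeff c) (T : E →ₗᵢ[ℝ] F) (t : ℝ) :
    T (expSeries c t) = expSeries (fun n => T (c n)) t := by
  have h := (hc.hasSum t).mapL T.toContinuousLinearMap
  have h2 := (hc.map T).hasSum t
  simp only [LinearIsometry.coe_toContinuousLinearMap, map_smul] at h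
  exact h.unique h2

end ExpSeries

/-! ### Exponential series in `Lᵖ` -/

section ExpSeriesLp

open Nat

variable {α E : Type*} [MeasurableSpace α] {μ : Measure α} [NormedAddCommGroup E]
  [NormedSpace ℝ E]

/-- Summable `L²` norms force almost sure absolute summability. Since `EntireCoeff` tests only
natural radii, countably many null sets suffice. -/
lemma EntireCoeff.ae_entireCoeff {c : ℕ → Lp E 2 μ} (hc : EntireCoeff c) :
    ∀ᵐ x ∂μ, EntireCoeff fun n => c n x := by
  refine ae_all_iff.2 fun r => ?_
  have h : ∑' n, eLpNorm (((r : ℝ) ^ n / n ! : ℝ) • c n : Lp E 2 μ) 2 μ ≠ ⊤ := by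
    simpa [Lp.enorm_def] using tsum_enorm_ne_top_iff_summable_norm.2 (hc.summable_norm r)
  have h1 : ∀ᵐ x ∂μ, ∀ n, (((r : ℝ) ^ n / n ! : ℝ) • c n : Lp E 2 μ) x
      = ((r : ℝ) ^ n / n ! : ℝ) • c n x :=
    ae_all_iff.2 fun n => Lp.coeFn_smul _ _
  filter_upwards [summable_norm_of_tsum_eLpNorm_ne_top (by norm_num)
    (fun n => Lp.aestronglyMeasurable _) h, h1] with x hx h1x
  refine hx.congr fun n => ?_
  rw [h1x, norm_smul, norm_div, norm_pow, RCLike.norm_natCast, RCLike.norm_natCast]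

variable [CompleteSpace E]

lemma EntireCoeff.ae_hasSum {c : ℕ → Lp E 2 μ} (hc : EntireCoeff c) (t : ℝ) :
    ∀ᵐ x ∂μ, HasSum (fun n => (t ^ n / n !) • c n x) (expSeries c t x) := by
  have h : ∑' n, ‖(t ^ n / n !) • c n‖ₑ ≠ ⊤ :=
    tsum_enorm_ne_top_iff_summable_norm.2 (hc.summable_norm t)
  have h1 : ∀ᵐ x ∂μ, ∀ n, ((t ^ n / n ! : ℝ) • c n : Lp E 2 μ) x = (t ^ n / n ! : ℝ) • c n x :=
    ae_all_iff.2 fun n => Lp.coeFn_smul _ _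
  filter_upwards [Lp.hasSum_coeFn_tsum h, h1] with x hx h1x
  simpa only [h1x, expSeries] using hx

end ExpSeriesLp

/-! ### Isometries from equality of Gram matrices -/

section Gram

variable {ι H G : Type*} [NormedAddCommGroup H] [InnerProductSpace ℝ H] [NormedAddCommGroup G]
  [InnerProductSpace ℝ G] [CompleteSpace G]

/-- The norm of a linear combination depends only on the Gram matrix, so `u i ↦ w i` is well defined
and isometric on the span, and extends to its closure by density. The control on the range later
transfers the vanishing of means. -/
lemma exists_linearIsometry_of_inner_eq (u : ι → H) (w : ι → G)
    (h : ∀ i j, inner ℝ (u i) (u j) = inner ℝ (w i) (w j)) :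
    ∃ K : Submodule ℝ H, IsClosed (K : Set H) ∧ (∀ i, u i ∈ K) ∧ ∃ T : K →ₗᵢ[ℝ] G,
      (∀ i (hi : u i ∈ K), T ⟨u i, hi⟩ = w i) ∧
      ∀ x, T x ∈ (Submodule.span ℝ (range w)).topologicalClosure := by
  set K := (Submodule.span ℝ (range u)).topologicalClosure
  have hu : ∀ i, u i ∈ K := fun i =>
    Submodule.le_topologicalClosure _ (Submodule.subset_span ⟨i, rfl⟩)
  let e : (ι →₀ ℝ) →ₗ[ℝ] K := Finsupp.linearCombination ℝ fun i => (⟨u i, hu i⟩ : K)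
  let f : (ι →₀ ℝ) →ₗ[ℝ] G := Finsupp.linearCombination ℝ w
  have hKe : K.subtype ∘ₗ e = Finsupp.linearCombination ℝ u := by
    ext i; simp [e]
  have hnorm : ∀ v, ‖f v‖ = ‖e v‖ := by
    intro v
    have h1 : ‖e v‖ = ‖Finsupp.linearCombination ℝ u v‖ := by
      rw [← hKe]; rfl
    rw [h1, ← sq_eq_sq₀ (norm_nonneg _) (norm_nonneg _), ← real_inner_self_eq_norm_sq,
      ← real_inner_self_eq_norm_sq]
    simp only [f, Finsupp.linearCombination_apply, Finsupp.sum, sum_inner, inner_sum,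
      real_inner_smul_left, real_inner_smul_right, h]
  have hdense : DenseRange e := by
    have h1 : Set.range (fun v => (e v : H)) = (Submodule.span ℝ (range u) : Set H) := by
      rw [← Finsupp.range_linearCombination, ← hKe]
      rfl
    intro x
    rw [Topology.IsInducing.subtypeVal.closure_eq_preimage_closure_image, mem_preimage,
      ← range_comp]
    change (x : H) ∈ closure (Set.range fun v => (e v : H))
    rw [h1]
    exact x.2
  have hb : ∃ C, ∀ x, ‖f x‖ ≤ C * ‖e x‖ := ⟨1, fun x => by rw [hnorm, one_mul]⟩
  let T := f.extendOfNorm e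
  have hT : ∀ v, T (e v) = f v := fun v => LinearMap.extendOfNorm_eq hdense hb v
  refine ⟨K, Submodule.isClosed_topologicalClosure _, hu, ⟨T.toLinearMap, fun x => ?_⟩,
    fun i hi => ?_, fun x => ?_⟩
  · refine hdense.induction_on (p := fun x => ‖T x‖ = ‖x‖) x
      (isClosed_eq (by fun_prop) (by fun_prop)) fun v => ?_
    rw [hT, hnorm]
  · have := hT (Finsupp.single i 1)
    simpa [e, f] using this
  · refine hdense.induction_on
      (p := fun x => T x ∈ (Submodule.span ℝ (range w)).topologicalClosure) x
      ((Submodule.isClosed_topologicalClosure _).preimage T.continuous) fun v => ?_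
    rw [hT]
    refine Submodule.le_topologicalClosure _ ?_
    rw [← Finsupp.range_linearCombination]
    exact ⟨v, rfl⟩

end Gram

/-! ### Linear independence of exponential monomials -/

section ExpMonomials

lemma tendsto_pow_mul_exp_ratio {s t : ℝ} {m n : ℕ} (h : s < t ∨ s = t ∧ m < n) :
    Tendsto (fun y : ℝ => y ^ m * Real.exp (s * y) / (y ^ n * Real.exp (t * y))) atTop (𝓝 0) := by
  rcases h with h | ⟨rfl, h⟩
  · have h1 : Tendsto (fun y : ℝ => y ^ m * Real.exp (-(t - s) * y)) atTop (𝓝 0) := by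
      simpa using tendsto_rpow_mul_exp_neg_mul_atTop_nhds_zero m (t - s) (sub_pos.2 h)
    have h2 : ∀ᶠ y : ℝ in atTop, ‖y ^ m * Real.exp (s * y) / (y ^ n * Real.exp (t * y))‖
        ≤ y ^ m * Real.exp (-(t - s) * y) := by
      filter_upwards [eventually_ge_atTop 1] with y hy
      have he : Real.exp (s * y) = Real.exp (-(t - s) * y) * Real.exp (t * y) := by
        rw [← Real.exp_add]; congr 1; ring
      rw [Real.norm_of_nonneg (by positivity), he, div_le_iff₀ (by positivity)]
      calc y ^ m * (Real.exp (-(t - s) * y) * Real.exp (t * y))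
          = (y ^ m * Real.exp (-(t - s) * y)) * (1 * Real.exp (t * y)) := by ring
        _ ≤ _ := by gcongr; exact one_le_pow₀ hy
    exact squeeze_zero_norm' h2 h1
  · have h1 : Tendsto (fun y : ℝ => y ^ m / y ^ n) atTop (𝓝 0) := tendsto_pow_div_pow_atTop_zero h
    refine h1.congr fun y => ?_
    rw [mul_div_mul_right _ _ (Real.exp_ne_zero _)]

/-- The functions `y ↦ yⁿ exp (t y)` are linearly independent on `ℝ`. -/
lemma eq_zero_of_sum_pow_mul_exp_eq_zero (I : Finset (ℝ × ℕ)) (v : ℝ × ℕ → ℝ)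
    (h : ∀ y : ℝ, ∑ p ∈ I, v p * (y ^ p.2 * Real.exp (p.1 * y)) = 0) :
    ∀ p ∈ I, v p = 0 := by
  by_contra! hne
  obtain ⟨p₀, hp₀, hv₀⟩ := hne
  -- The lexicographically largest pair with nonzero coefficient dominates at `+∞`; dividing by its
  -- monomial leaves `v q` in the limit.
  obtain ⟨q, hq, hmax⟩ := (I.filter fun p => v p ≠ 0).exists_max_image (fun p => toLex p)
    ⟨p₀, by simp [hp₀, hv₀]⟩
  rw [Finset.mem_filter] at hq
  have hlim : Tendsto (fun y : ℝ => ∑ p ∈ I, v p * (y ^ p.2 * Real.exp (p.1 * y)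
      / (y ^ q.2 * Real.exp (q.1 * y)))) atTop (𝓝 (∑ p ∈ I, if p = q then v q else 0)) := by
    refine tendsto_finsetSum _ fun p hp => ?_
    by_cases hpq : p = q
    · subst hpq
      simp only [if_true]
      refine tendsto_const_nhds.congr' ?_
      filter_upwards [eventually_gt_atTop 0] with y hy
      rw [div_self (by positivity), mul_one]
    · rw [if_neg hpq]
      by_cases hvp : v p = 0
      · simp [hvp]
      · have hle : toLex p < toLex q := lt_of_le_of_ne (hmax p (by simp [hp, hvp])) (by simpa)
        rw [Prod.Lex.toLex_lt_toLex] at hle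
        simpa using (tendsto_pow_mul_exp_ratio hle).const_mul (v p)
  have hzero : ∀ y : ℝ, ∑ p ∈ I, v p * (y ^ p.2 * Real.exp (p.1 * y)
      / (y ^ q.2 * Real.exp (q.1 * y))) = 0 := fun y => by
    have := h y
    simp_rw [← mul_div_assoc, ← Finset.sum_div]
    rw [this, zero_div]
  simp only [hzero] at hlim
  have := tendsto_nhds_unique hlim tendsto_const_nhds
  rw [Finset.sum_ite_eq' I q, if_pos hq.1] at this
  exact hq.2 this

end ExpMonomials

/-! ### Entire functions vanishing almost everywhere -/

/-- The real zeros form a closed set of full measure, which therefore contains the support. They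
accumulate, and the identity theorem applies. -/
lemma Differentiable.eq_zero_of_ae_eq_zero {F : Measure ℝ}
    (hF : ∃ x : ℝ, AccPt x (𝓟 F.support)) {h : ℂ → ℂ} (hh : Differentiable ℂ h)
    (h0 : ∀ᵐ x : ℝ ∂F, h x = 0) (z : ℂ) : h z = 0 := by
  have hsupp : F.support ⊆ {x : ℝ | h x = 0} := by
    refine Measure.support_subset_of_isClosed ?_ h0
    exact isClosed_eq (hh.continuous.comp Complex.continuous_ofReal) continuous_const
  obtain ⟨x, hx⟩ := hF
  have hfreq : ∃ᶠ y : ℝ in 𝓝[≠] x, h y = 0 :=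
    (accPt_iff_frequently_nhdsNE.1 hx).mono fun y hy => hsupp hy
  have ht : Tendsto (fun y : ℝ => (y : ℂ)) (𝓝[≠] x) (𝓝[≠] (x : ℂ)) := by
    refine tendsto_nhdsWithin_iff.2
      ⟨(Complex.continuous_ofReal.tendsto x).mono_left nhdsWithin_le_nhds, ?_⟩
    filter_upwards [self_mem_nhdsWithin] with y hy
    simpa using hy
  have hfreq2 : ∃ᶠ w : ℂ in 𝓝[≠] (x : ℂ), h w = 0 := ht.frequently hfreq
  exact AnalyticOnNhd.eqOn_zero_of_preconnected_of_frequently_eq_zero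
    (hh.differentiableOn.analyticOnNhd isOpen_univ) isPreconnected_univ (mem_univ _) hfreq2
    (mem_univ z)

/-! ### Spectral functions in `L²(F)` -/

namespace GaussianMinima

open Nat

/-- The function `x ↦ (ix)ⁿ exp(itx)`, the spectral representation of the `n`-th derivative of the
process at time `t`. -/
noncomputable def specFun (t : ℝ) (n : ℕ) (x : ℝ) : ℂ :=
  (Complex.I * x) ^ n * Complex.exp (Complex.I * t * x)

lemma continuous_specFun (t : ℝ) (n : ℕ) : Continuous (specFun t n) := by
  unfold specFun
  fun_prop

lemma norm_exp_I_mul_mul (t x : ℝ) : ‖Complex.exp (Complex.I * t * x)‖ = 1 := by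
  rw [show Complex.I * t * x = ((t * x : ℝ) : ℂ) * Complex.I by push_cast; ring]
  exact Complex.norm_exp_ofReal_mul_I _

lemma norm_specFun (t : ℝ) (n : ℕ) (x : ℝ) : ‖specFun t n x‖ = |x| ^ n := by
  rw [specFun, norm_mul, norm_exp_I_mul_mul, norm_pow, norm_mul, Complex.norm_I, one_mul, mul_one,
    Complex.norm_real, Real.norm_eq_abs]

lemma hasSum_specFun (t : ℝ) (n : ℕ) (x : ℝ) :
    HasSum (fun k : ℕ => (t ^ k / k ! : ℝ) • specFun 0 (k + n) x) (specFun t n x) := by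
  have h := (NormedSpace.expSeries_div_hasSum_exp (Complex.I * t * x)).mul_left
    ((Complex.I * x) ^ n)
  rw [← Complex.exp_eq_exp_ℂ] at h
  convert! h using 2 with k
  simp only [specFun, Complex.real_smul, Complex.ofReal_div, Complex.ofReal_pow,
    Complex.ofReal_natCast, Complex.ofReal_zero, mul_zero, zero_mul, Complex.exp_zero, mul_one]
  ring

variable {F : Measure ℝ}

lemma HasExpMoments.integrable_exp_abs (hF : HasExpMoments F) (t : ℝ) :
    Integrable (fun x : ℝ => Real.exp (t * |x|)) F :=
  integrable_exp_mul_abs (X := id) (hF t) (hF (-t))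

lemma HasExpMoments.memLp_exp_abs (hF : HasExpMoments F) (t : ℝ) :
    MemLp (fun x : ℝ => Real.exp (t * |x|)) 2 F := by
  rw [memLp_two_iff_integrable_sq (by fun_prop)]
  refine (hF.integrable_exp_abs (2 * t)).congr (ae_of_all _ fun x => ?_)
  simp only
  rw [← Real.exp_nat_mul]
  congr 1
  push_cast
  ring

lemma HasExpMoments.memLp_specFun (hF : HasExpMoments F) (t : ℝ) (n : ℕ) :
    MemLp (specFun t n) 2 F := by
  refine ((hF.memLp_exp_abs 1).const_mul (n ! : ℝ)).mono
    (continuous_specFun t n).aestronglyMeasurable (ae_of_all _ fun x => ?_)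
  rw [norm_specFun, Real.norm_of_nonneg (by positivity), one_mul]
  have := Real.pow_div_factorial_le_exp |x| (abs_nonneg x) n
  rwa [div_le_iff₀ (by positivity), mul_comm] at this

/-- `specFun t n` as an element of `L²(F)`. -/
noncomputable def specLp (hF : HasExpMoments F) (t : ℝ) (n : ℕ) : Lp ℂ 2 F :=
  (hF.memLp_specFun t n).toLp _

lemma entireCoeff_specLp (hF : HasExpMoments F) : EntireCoeff fun n => specLp hF 0 n := by
  intro r
  set C := ‖(hF.memLp_exp_abs (2 * (r + 1))).toLp‖
  -- A single term of the exponential series is at most `exp (2(r+1)|x|)`, which is in `L²(F)` by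
  -- S1. The factor 2 leaves a geometric series; the `+ 1` keeps the radius positive.
  have hb : ∀ n, (2 * ((r : ℝ) + 1)) ^ n / n ! * ‖specLp hF 0 n‖ ≤ C := by
    intro n
    rw [← Real.norm_of_nonneg (show 0 ≤ (2 * ((r : ℝ) + 1)) ^ n / (n ! : ℝ) by positivity), ← norm_smul]
    refine Lp.norm_le_norm_of_ae_le ?_
    filter_upwards [Lp.coeFn_smul ((2 * ((r : ℝ) + 1)) ^ n / n !) (specLp hF 0 n),
      (hF.memLp_specFun 0 n).coeFn_toLp, (hF.memLp_exp_abs (2 * (r + 1))).coeFn_toLp]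
      with x h1 h2 h3
    rw [h1, h3, Pi.smul_apply, norm_smul, specLp, h2, norm_specFun,
      Real.norm_of_nonneg (by positivity), Real.norm_of_nonneg (by positivity)]
    have := Real.pow_div_factorial_le_exp (2 * ((r : ℝ) + 1) * |x|) (by positivity) n
    rw [mul_pow] at this
    linarith [this, div_mul_eq_mul_div ((2 * ((r : ℝ) + 1)) ^ n) (n ! : ℝ) (|x| ^ n)]
  have hs : Summable fun n : ℕ => C * (1 / 2 : ℝ) ^ n := summable_geometric_two.mul_left C
  refine hs.of_nonneg_of_le (fun n => by positivity) fun n => ?_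
  have h1 : (r : ℝ) ^ n ≤ ((r : ℝ) + 1) ^ n := by gcongr; linarith
  calc (r : ℝ) ^ n / n ! * ‖specLp hF 0 n‖ ≤ ((r : ℝ) + 1) ^ n / n ! * ‖specLp hF 0 n‖ := by gcongr
    _ = ((2 * ((r : ℝ) + 1)) ^ n / n ! * ‖specLp hF 0 n‖) * (1 / 2) ^ n := by
      rw [mul_pow, one_div, inv_pow]; field_simp
    _ ≤ C * (1 / 2) ^ n := by gcongr; exact hb n

lemma expSeries_specLp (hF : HasExpMoments F) (t : ℝ) (n : ℕ) :
    expSeries (fun k => specLp hF 0 (k + n)) t = specLp hF t n := by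
  refine Lp.ext ?_
  have h1 : ∀ᵐ x ∂F, ∀ k, specLp hF 0 (k + n) x = specFun 0 (k + n) x :=
    ae_all_iff.2 fun k => (hF.memLp_specFun 0 (k + n)).coeFn_toLp
  filter_upwards [((entireCoeff_specLp hF).add_right n).ae_hasSum t, h1,
    (hF.memLp_specFun t n).coeFn_toLp] with x hx h1x h2x
  simp only [h1x] at hx
  rw [specLp, h2x]
  exact hx.unique (hasSum_specFun t n x)

lemma linearIndependent_specLp (hF : HasExpMoments F) (hacc : SupportHasAccPt F)
    (I : Finset (ℝ × ℕ)) : LinearIndependent ℝ fun p : I => specLp hF p.1.1 p.1.2 := by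
  rw [Fintype.linearIndependent_iff]
  intro g hg
  let v : ℝ × ℕ → ℝ := fun p => if h : p ∈ I then g ⟨p, h⟩ else 0
  let Q : ℂ → ℂ := fun z => ∑ p ∈ I, (v p : ℂ) *
    ((Complex.I * z) ^ p.2 * Complex.exp (Complex.I * p.1 * z))
  have hQ : Differentiable ℂ Q := by
    unfold Q
    fun_prop
  have h0 : ∀ᵐ x : ℝ ∂F, Q x = 0 := by
    have h1 : ∀ᵐ x ∂F, ∀ p : I, (g p • specLp hF p.1.1 p.1.2 : Lp ℂ 2 F) x
        = g p • specFun p.1.1 p.1.2 x := by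
      refine ae_all_iff.2 fun p => ?_
      filter_upwards [Lp.coeFn_smul (g p) (specLp hF p.1.1 p.1.2),
        (hF.memLp_specFun p.1.1 p.1.2).coeFn_toLp] with x hx h2x
      rw [hx, Pi.smul_apply, specLp, h2x]
    have h2 := Lp.coeFn_fun_finsetSum Finset.univ fun p : I => g p • specLp hF p.1.1 p.1.2
    rw [hg] at h2
    filter_upwards [h1, h2, Lp.coeFn_zero ℂ 2 F] with x h1x h2x h3x
    rw [h3x] at h2x
    simp only [h1x] at h2x
    unfold Q
    rw [← Finset.sum_coe_sort I]
    rw [Pi.zero_apply] at h2x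
    rw [h2x]
    refine Finset.sum_congr rfl fun p _ => ?_
    simp [v, specFun]
  have hz := hQ.eq_zero_of_ae_eq_zero hacc h0
  have hreal : ∀ y : ℝ, ∑ p ∈ I, v p * (y ^ p.2 * Real.exp (p.1 * y)) = 0 := by
    intro y
    -- On the imaginary axis the oscillating functions become `y^n e^{ty}`, whose growth rates
    -- separate them.
    have := hz (-Complex.I * y)
    unfold Q at this
    have h1 : ∀ p : ℝ × ℕ, Complex.I * p.1 * (-Complex.I * y) = p.1 * y := fun p => by
      linear_combination (-(p.1 : ℂ) * y) * Complex.I_mul_I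
    have h2 : Complex.I * (-Complex.I * y) = y := by
      linear_combination (-(y : ℂ)) * Complex.I_mul_I
    simp only [h1, h2] at this
    exact_mod_cast this
  intro p
  have := eq_zero_of_sum_pow_mul_exp_eq_zero I v hreal p p.2
  simpa [v] using this

/-! ### The covariance function -/

variable {Ω : Type*} [MeasurableSpace Ω] {P : Measure Ω} {X : ℝ → Ω → ℝ}

lemma IsSpectralMeasure.covFun_eq_integral_specFun (hspec : IsSpectralMeasure X P F) (s t : ℝ) :
    (covFun X P s t : ℂ) = ∫ x, specFun (-s) 0 x * specFun t 0 x ∂F := by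
  rw [hspec.covFun_eq]
  refine integral_congr_ae (ae_of_all _ fun x => ?_)
  simp only [specFun, pow_zero, one_mul]
  rw [← Complex.exp_add]
  congr 1
  push_cast
  ring

/-- As `R` is real, taking real parts loses nothing, so `L²(F; ℂ)` viewed as a real Hilbert space
has the Gram matrix of the process. -/
lemma IsSpectralMeasure.covFun_eq_integral_inner (hspec : IsSpectralMeasure X P F) (s t : ℝ) :
    covFun X P s t = ∫ x, inner ℝ (specFun s 0 x) (specFun t 0 x) ∂F := by
  have := hspec.finite
  have hi : Integrable (fun x => specFun (-s) 0 x * specFun t 0 x) F := by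
    refine Integrable.of_bound ((continuous_specFun _ _).mul
      (continuous_specFun _ _)).aestronglyMeasurable 1 (ae_of_all _ fun x => ?_)
    simp [norm_specFun]
  have h := congrArg Complex.re (hspec.covFun_eq_integral_specFun s t)
  rw [Complex.ofReal_re] at h
  rw [h]
  change RCLike.re (∫ x, specFun (-s) 0 x * specFun t 0 x ∂F) = _
  rw [← integral_re hi]
  refine integral_congr_ae (ae_of_all _ fun x => ?_)
  have hc : specFun (-s) 0 x = (starRingEnd ℂ) (specFun s 0 x) := by
    simp [specFun, ← Complex.exp_conj]
  simp only [hc, Complex.inner, RCLike.re_to_complex, mul_comm]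

lemma _root_.HasSum.mul_prod {𝕜 ι κ : Type*} [RCLike 𝕜] {f : ι → 𝕜} {g : κ → 𝕜} {a b : 𝕜}
    (hf : HasSum f a) (hg : HasSum g b) : HasSum (fun p : ι × κ => f p.1 * g p.2) (a * b) :=
  hf.mul hg (summable_mul_of_summable_norm hf.summable.norm hg.summable.norm)

/-- The product of the series of `e^{-isx}` and `e^{itx}` is dominated by `exp((|s|+|t|)|x|)`,
integrable by S1, so it can be integrated term by term. -/
lemma IsSpectralMeasure.hasPowerExpansion (hspec : IsSpectralMeasure X P F)
    (hF : HasExpMoments F) : HasPowerExpansion (covFun X P) := by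
  have := hspec.finite
  let a : ℕ × ℕ → ℝ → ℂ := fun p x =>
    ((-1 : ℝ) ^ p.1 / p.1 ! / p.2 ! : ℝ) * (specFun 0 p.1 x * specFun 0 p.2 x)
  refine ⟨fun m n => (∫ x, a (m, n) x ∂F).re, fun s t => ?_⟩
  have hexp : ∀ r x : ℝ, HasSum (fun n : ℕ => (|r| * |x|) ^ n / n !) (Real.exp (|r| * |x|)) := by
    intro r x
    rw [Real.exp_eq_exp_ℝ]
    exact NormedSpace.expSeries_div_hasSum_exp _
  have hb : ∀ x : ℝ, HasSum (fun p : ℕ × ℕ => (|s| * |x|) ^ p.1 / p.1 ! * ((|t| * |x|) ^ p.2 / p.2 !))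
      (Real.exp ((|s| + |t|) * |x|)) := by
    intro x
    rw [add_mul, Real.exp_add]
    have h1 := hexp s x
    have h2 := hexp t x
    exact h1.mul_prod h2
  have hmeas : ∀ p : ℕ × ℕ, AEStronglyMeasurable
      (fun x => ((s ^ p.1 * t ^ p.2 : ℝ) : ℂ) * a p x) F := fun p => by
    have := continuous_specFun 0 p.1
    have := continuous_specFun 0 p.2
    exact Continuous.aestronglyMeasurable (by fun_prop)
  have hle : ∀ (p : ℕ × ℕ) (x : ℝ), ‖((s ^ p.1 * t ^ p.2 : ℝ) : ℂ) * a p x‖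
      ≤ (|s| * |x|) ^ p.1 / p.1 ! * ((|t| * |x|) ^ p.2 / p.2 !) := fun p x => by
    simp only [a, norm_mul, norm_specFun, Complex.norm_real, norm_div, norm_pow, Real.norm_eq_abs,
      abs_neg, abs_one, one_pow, Nat.abs_cast, mul_pow]
    apply le_of_eq
    ring
  have hsum : ∀ x : ℝ, HasSum (fun p : ℕ × ℕ => ((s ^ p.1 * t ^ p.2 : ℝ) : ℂ) * a p x)
      (specFun (-s) 0 x * specFun t 0 x) := fun x => by
    have h1 := hasSum_specFun (-s) 0 x
    have h2 := hasSum_specFun t 0 x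
    have h3 := h1.mul_prod h2
    convert! h3 using 2 with p
    simp only [a, add_zero, Complex.real_smul]
    push_cast
    rw [neg_pow (s : ℂ)]
    ring
  have hint : Integrable (fun x : ℝ => ∑' p : ℕ × ℕ,
      (|s| * |x|) ^ p.1 / p.1 ! * ((|t| * |x|) ^ p.2 / p.2 !)) F := by
    simp only [(hb _).tsum_eq]
    exact hF.integrable_exp_abs _
  have h := hasSum_integral_of_dominated_convergence _ hmeas (fun p => ae_of_all _ (hle p))
    (ae_of_all _ fun x => (hb x).summable) hint (ae_of_all _ hsum)
  rw [← hspec.covFun_eq_integral_specFun] at h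
  have h2 := Complex.hasSum_re h
  rw [Complex.ofReal_re] at h2
  convert! h2 using 2 with p
  rw [integral_const_mul, Complex.re_ofReal_mul]
  ring

end GaussianMinima

namespace GaussianMinima

variable {Ω : Type*} [MeasurableSpace Ω] {P : Measure Ω} {X : ℝ → Ω → ℝ} {F : Measure ℝ}

/-! ### Smoothness and non-degeneracy of the derivatives -/

lemma exists_isometry_specLp (hF : HasExpMoments F)
    (hspec : IsSpectralMeasure X P F) (hX : ∀ t, MemLp (X t) 2 P) :
    ∃ K : Submodule ℝ (Lp ℂ 2 F), IsClosed (K : Set (Lp ℂ 2 F)) ∧ (∀ t, specLp hF t 0 ∈ K) ∧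
      ∃ T : K →ₗᵢ[ℝ] Lp ℝ 2 P, (∀ t h, T ⟨specLp hF t 0, h⟩ = (hX t).toLp) ∧
      ∀ x, T x ∈ (Submodule.span ℝ (range fun t => (hX t).toLp)).topologicalClosure := by
  refine exists_linearIsometry_of_inner_eq (fun t => specLp hF t 0) (fun t => (hX t).toLp)
    fun s t => ?_
  rw [L2.inner_def, L2.inner_def]
  calc ∫ x, inner ℝ (specLp hF s 0 x) (specLp hF t 0 x) ∂F
      = ∫ x, inner ℝ (specFun s 0 x) (specFun t 0 x) ∂F := by
        refine integral_congr_ae ?_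
        filter_upwards [(hF.memLp_specFun s 0).coeFn_toLp, (hF.memLp_specFun t 0).coeFn_toLp]
          with x h1 h2
        rw [specLp, specLp, h1, h2]
    _ = covFun X P s t := (hspec.covFun_eq_integral_inner s t).symm
    _ = ∫ ω, inner ℝ ((hX s).toLp _ ω) ((hX t).toLp _ ω) ∂P := by
        refine integral_congr_ae ?_
        filter_upwards [(hX s).coeFn_toLp, (hX t).coeFn_toLp] with x h1 h2
        rw [h1, h2]
        simp [mul_comm]

lemma smoothNondegenerate [IsProbabilityMeasure P] (hF : HasExpMoments F)
    (hacc : SupportHasAccPt F) (hspec : IsSpectralMeasure X P F) (hX : ∀ t, MemLp (X t) 2 P)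
    (hmean : ∀ t, ∫ ω, X t ω ∂P = 0) (hcont : ∀ᵐ ω ∂P, Continuous fun t => X t ω) :
    SmoothNondegenerate X P := by
  obtain ⟨K, hKc, hKmem, T, hT, hTspan⟩ := exists_isometry_specLp hF hspec hX
  have : CompleteSpace K := hKc.completeSpace_coe
  have hE := entireCoeff_specLp hF
  have hmem : ∀ t n, specLp hF t n ∈ K := by
    intro t n
    rw [← expSeries_specLp]
    refine hE.mem_of_forall_mem hKc (fun t => ?_) n t
    rw [show expSeries (fun n => specLp hF 0 n) t = specLp hF t 0 from expSeries_specLp hF t 0]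
    exact hKmem t
  let e : ℝ → ℕ → K := fun t n => ⟨specLp hF t n, hmem t n⟩
  let D : ℕ → Lp ℝ 2 P := fun n => T (e 0 n)
  have he : EntireCoeff fun n => e 0 n := hE
  have hD : EntireCoeff D := he.map T
  have hTe : ∀ t n, T (e t n) = expSeries (fun k => D (k + n)) t := by
    intro t n
    have h1 : e t n = expSeries (fun k => e 0 (k + n)) t := by
      apply Subtype.ext
      have := (he.add_right n).map_expSeries K.subtypeₗᵢ t
      exact (expSeries_specLp hF t n).symm.trans this.symm
    rw [h1]
    exact (he.add_right n).map_expSeries T t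
  have hval : ∀ t n, ∀ᵐ ω ∂P, expSeries (fun k => D (k + n) ω) t = T (e t n) ω := by
    intro t n
    filter_upwards [(hD.add_right n).ae_hasSum t] with ω hω
    rw [hTe]
    exact hω.tsum_eq
  have hpath : ∀ᵐ ω ∂P, EntireCoeff (fun k => D k ω) ∧
      (fun t => X t ω) = expSeries fun k => D k ω := by
    have h1 : ∀ᵐ ω ∂P, ∀ q : ℚ, expSeries (fun k => D k ω) q = X q ω := by
      refine ae_all_iff.2 fun q => ?_
      have h2 : T (e q 0) = (hX q).toLp := hT q (hmem q 0)
      filter_upwards [hval q 0, (hX q).coeFn_toLp] with ω h3 h4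
      rw [h2, h4] at h3
      exact h3
    filter_upwards [h1, hcont, hD.ae_entireCoeff] with ω hω hc hent
    refine ⟨hent, ?_⟩
    -- Both sides are continuous in `t`, so agreement at the rationals, obtained from countably many
    -- null sets, is agreement everywhere.
    refine Rat.isDenseEmbedding_coe_real.dense.equalizer hc hent.continuous ?_
    funext q
    exact (hω q).symm
  have hderiv : ∀ p : ℝ × ℕ, pathDeriv X p =ᵐ[P] T (e p.1 p.2) := by
    intro p
    filter_upwards [hpath, hval p.1 p.2] with ω hω h2
    rw [pathDeriv, hω.2, hω.1.iteratedDeriv]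
    exact h2
  have hmem2 : ∀ p : ℝ × ℕ, MemLp (pathDeriv X p) 2 P := fun p =>
    (memLp_congr_ae (hderiv p)).2 (Lp.memLp _)
  refine ⟨?_, hmem2, fun I => ?_⟩
  · filter_upwards [hpath] with ω hω
    rw [hω.2]
    exact hω.1.contDiff
  · have hmean0 : ∀ x : K, ∫ ω, T x ω ∂P = 0 := by
      have hone : ∀ y : Lp ℝ 2 P, ∫ ω, y ω ∂P
          = inner ℝ ((memLp_const (1 : ℝ)).toLp (fun _ : Ω => (1 : ℝ))) y := by
        intro y
        rw [L2.inner_def]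
        refine integral_congr_ae ?_
        filter_upwards [(memLp_const (μ := P) (p := 2) (1 : ℝ)).coeFn_toLp] with ω hω
        rw [hω]
        simp
      intro x
      -- Having mean zero is orthogonality to the constant 1, a closed condition; it passes from the
      -- `X_t` to the whole range of `T`.
      let V := LinearMap.ker (innerSL ℝ ((memLp_const (1 : ℝ)).toLp (fun _ : Ω => (1 : ℝ)) :
        Lp ℝ 2 P)).toLinearMap
      have hV : ∀ y : Lp ℝ 2 P, y ∈ V ↔ ∫ ω, y ω ∂P = 0 := fun y => by
        rw [hone]
        rfl
      have hVc : IsClosed (V : Set (Lp ℝ 2 P)) := ContinuousLinearMap.isClosed_ker _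
      rw [← hV]
      refine Submodule.topologicalClosure_minimal _ (Submodule.span_le.2 ?_) hVc (hTspan x)
      rintro _ ⟨t, rfl⟩
      rw [SetLike.mem_coe, hV, integral_congr_ae (hX t).coeFn_toLp, hmean]
    have hmean1 : ∀ p : ℝ × ℕ, ∫ ω, pathDeriv X p ω ∂P = 0 := fun p => by
      rw [integral_congr_ae (hderiv p), hmean0]
    have hgram : (Matrix.of fun p q : I => covariance (pathDeriv X p) (pathDeriv X q) P)
        = Matrix.gram ℝ fun p : I => e p.1.1 p.1.2 := by
      ext p q
      rw [Matrix.of_apply, Matrix.gram_apply, covariance_eq_sub (hmem2 _) (hmem2 _), hmean1,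
        zero_mul, sub_zero, ← T.inner_map_map, L2.inner_def]
      refine integral_congr_ae ?_
      filter_upwards [hderiv p, hderiv q] with ω h1 h2
      rw [Pi.mul_apply, h1, h2]
      simp [mul_comm]
    rw [hgram, Matrix.det_gram_ne_zero_iff_linearIndependent]
    exact LinearIndependent.of_comp K.subtype (linearIndependent_specLp hF hacc I)

/-! ### Integrals of the process -/

/-- A process with almost surely continuous paths is almost surely equal to a jointly measurable
process with continuous paths. -/
lemma exists_measurable_modification (hX : ∀ t, AEMeasurable (X t) P)
    (hcont : ∀ᵐ ω ∂P, Continuous fun t => X t ω) :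
    ∃ Y : ℝ → Ω → ℝ, Measurable (Function.uncurry Y) ∧ (∀ ω, Continuous fun t => Y t ω) ∧
      ∀ᵐ ω ∂P, ∀ t, X t ω = Y t ω := by
  have hae : ∀ᵐ ω ∂P, (Continuous fun t => X t ω) ∧ ∀ q : ℚ, X q ω = (hX q).mk _ ω :=
    hcont.and (ae_all_iff.2 fun q => (hX q).ae_eq_mk)
  obtain ⟨N, hN, hNm, hNP⟩ := exists_measurable_superset_of_null (ae_iff.1 hae)
  have hgood : ∀ ω ∈ Nᶜ, (Continuous fun t => X t ω) ∧ ∀ q : ℚ, X q ω = (hX q).mk _ ω := by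
    intro ω hω
    by_contra h
    exact hω (hN h)
  have hYc : ∀ ω, Continuous fun t => Nᶜ.indicator (X t) ω := by
    intro ω
    by_cases hω : ω ∈ Nᶜ
    · simpa only [indicator_of_mem hω] using (hgood ω hω).1
    · simpa only [indicator_of_notMem hω] using continuous_const
  have hYq : ∀ q : ℚ, Measurable (Nᶜ.indicator (X q)) := by
    intro q
    have : Nᶜ.indicator (X q) = Nᶜ.indicator ((hX q).mk _) :=
      indicator_congr fun ω hω => (hgood ω hω).2 q
    rw [this]
    exact (hX q).measurable_mk.indicator hNm.compl
  refine ⟨fun t => Nᶜ.indicator (X t), measurable_uncurry_of_continuous_of_measurable hYc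
    fun t => ?_, hYc, ?_⟩
  -- At rational times the modification is measurable by construction; at other times it is a
  -- pointwise limit of these along the continuous paths.
  · obtain ⟨x, hx, hxt⟩ := mem_closure_iff_seq_limit.1
      (Rat.isDenseEmbedding_coe_real.dense.closure_range ▸ mem_univ t)
    choose q hq using hx
    refine measurable_of_tendsto_metrizable (f := fun n => Nᶜ.indicator (X (x n)))
      (fun n => hq n ▸ hYq (q n)) ?_
    exact tendsto_pi_nhds.2 fun ω => ((hYc ω).tendsto t).comp hxt
  · filter_upwards [compl_mem_ae_iff.2 hNP] with ω hω t
    rw [indicator_of_mem hω]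

lemma charFun_eq_complexMGF_mul_I (ν : Measure ℝ) (x : ℝ) :
    charFun ν x = complexMGF id ν (x * Complex.I) := complexMGF_id_mul_I x |>.symm

/-- If the characteristic function of a compactly supported probability measure is square
integrable against a measure whose support has an accumulation point, its `L²` norm is positive. -/
lemma integral_norm_charFun_sq_pos [IsFiniteMeasure F] (hacc : SupportHasAccPt F) {ν : Measure ℝ}
    [IsProbabilityMeasure ν] {a b : ℝ} (hν : ∀ᵐ t ∂ν, t ∈ Icc a b) :
    0 < ∫ x, ‖charFun ν x‖ ^ 2 ∂F := by
  have hint : Integrable (fun x => ‖charFun ν x‖ ^ 2) F := by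
    refine Integrable.of_bound (by fun_prop) 1 (ae_of_all _ fun x => ?_)
    rw [norm_pow, norm_norm]
    exact pow_le_one₀ (norm_nonneg _) (norm_charFun_le_one x)
  refine lt_of_le_of_ne (integral_nonneg fun x => by positivity) fun h0 => ?_
  have hae : ∀ᵐ x : ℝ ∂F, complexMGF id ν (x * Complex.I) = 0 := by
    filter_upwards [(integral_eq_zero_iff_of_nonneg (fun x => by positivity) hint).1 h0.symm]
      with x hx
    rw [← charFun_eq_complexMGF_mul_I]
    simpa using hx
  -- Compact support gives all exponential moments, so the characteristic function extends to the
  -- entire function `z ↦ complexMGF id ν (z * I)`. Its value at 0 is the total mass 1, so it cannot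
  -- vanish identically.
  have hset : integrableExpSet id ν = univ := by
    refine eq_univ_of_forall fun t => ?_
    have hc : Continuous fun x : ℝ => Real.exp (t * id x) := by fun_prop
    have : IntegrableOn (fun x : ℝ => Real.exp (t * id x)) (Icc a b) ν := hc.integrableOn_Icc
    rwa [IntegrableOn, Measure.restrict_eq_self_of_ae_mem hν] at this
  have hdiff : Differentiable ℂ fun z => complexMGF id ν (z * Complex.I) := by
    intro z
    have h1 : DifferentiableAt ℂ (complexMGF id ν) (z * Complex.I) :=
      (hasDerivAt_complexMGF (by simp [hset])).differentiableAt
    exact DifferentiableAt.fun_comp' z h1 (by fun_prop)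
  have := hdiff.eq_zero_of_ae_eq_zero hacc hae 0
  simp [complexMGF] at this

/-- By Fubini, integrating `e^{-isx} e^{itx}` over `ν ⊗ ν` first gives the product of the
characteristic function and its conjugate. -/
lemma IsSpectralMeasure.integral_covFun_eq (hspec : IsSpectralMeasure X P F) {ν : Measure ℝ}
    [IsProbabilityMeasure ν] :
    ∫ z : ℝ × ℝ, covFun X P z.1 z.2 ∂(ν.prod ν) = ∫ x, ‖charFun ν x‖ ^ 2 ∂F := by
  have := hspec.finite
  have hchar : ∀ x, charFun ν x = ∫ t, specFun t 0 x ∂ν := fun x => by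
    rw [charFun_apply_real]
    refine integral_congr_ae (ae_of_all _ fun t => ?_)
    simp only [specFun, pow_zero, one_mul]
    congr 1
    ring
  have hconj : ∀ x, (starRingEnd ℂ) (charFun ν x) = ∫ t, specFun (-t) 0 x ∂ν := fun x => by
    rw [hchar, ← integral_conj]
    refine integral_congr_ae (ae_of_all _ fun t => ?_)
    simp [specFun, ← Complex.exp_conj]
  rw [← Complex.ofReal_inj, ← integral_complex_ofReal, ← integral_complex_ofReal]
  have hswap : Integrable (fun w : (ℝ × ℝ) × ℝ => specFun (-w.1.1) 0 w.2 * specFun w.1.2 0 w.2)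
      ((ν.prod ν).prod F) := by
    refine Integrable.of_bound (Continuous.aestronglyMeasurable ?_) 1 (ae_of_all _ fun w => ?_)
    · unfold specFun
      fun_prop
    · simp [norm_specFun]
  calc ∫ z : ℝ × ℝ, (covFun X P z.1 z.2 : ℂ) ∂(ν.prod ν)
      = ∫ z : ℝ × ℝ, ∫ x, specFun (-z.1) 0 x * specFun z.2 0 x ∂F ∂(ν.prod ν) := by
        simp only [hspec.covFun_eq_integral_specFun]
    _ = ∫ x, ∫ z : ℝ × ℝ, specFun (-z.1) 0 x * specFun z.2 0 x ∂(ν.prod ν) ∂F :=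
        integral_integral_swap hswap
    _ = ∫ x, ((‖charFun ν x‖ ^ 2 : ℝ) : ℂ) ∂F := by
        refine integral_congr_ae (ae_of_all _ fun x => ?_)
        simp only
        rw [integral_prod_mul (fun s => specFun (-s) 0 x) (fun t => specFun t 0 x), ← hchar,
          ← hconj, Complex.conj_mul']
        push_cast
        rfl

lemma nonnegNondegenerateOn [IsProbabilityMeasure P]
    (hacc : SupportHasAccPt F) (hspec : IsSpectralMeasure X P F) (hX : ∀ t, MemLp (X t) 2 P)
    (hmean : ∀ t, ∫ ω, X t ω ∂P = 0) (hcont : ∀ᵐ ω ∂P, Continuous fun t => X t ω) (a b : ℝ) :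
    NonnegNondegenerateOn X P a b := by
  intro ν hν hνab
  have := hspec.finite
  have hνae : ∀ᵐ t ∂ν, t ∈ Icc a b := (prob_compl_eq_zero_iff measurableSet_Icc).2 hνab
  rw [Measure.restrict_eq_self_of_ae_mem hνae]
  obtain ⟨Y, hYm, hYc, hXY⟩ := exists_measurable_modification
    (fun t => (hX t).aestronglyMeasurable.aemeasurable) hcont
  have hXYt : ∀ t, X t =ᵐ[P] Y t := fun t => hXY.mono fun ω h => h t
  have hY : ∀ t, MemLp (Y t) 2 P := fun t => (memLp_congr_ae (hXYt t)).1 (hX t)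
  have hcov : ∀ s t, ∫ ω, Y s ω * Y t ω ∂P = covFun X P s t := fun s t =>
    integral_congr_ae (by filter_upwards [hXY] with ω h; rw [h, h])
  -- The second moment is the same for all `t`. With `|y| ≤ 1 + y²` and `|yz| ≤ y² + z²` this bounds
  -- the inner integrals uniformly, as both uses of Fubini require.
  have hvar : ∀ t, ∫ ω, Y t ω ^ 2 ∂P = F.real univ := by
    intro t
    simp only [pow_two, hcov]
    have := hspec.covFun_eq t t
    simp only [sub_self, Complex.ofReal_zero, mul_zero, zero_mul, Complex.exp_zero,
      integral_const, Complex.real_smul, mul_one] at this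
    exact_mod_cast this
  have hYsq : ∀ t, Integrable (fun ω => Y t ω ^ 2) P := fun t => (hY t).integrable_sq
  have hint1 : Integrable (fun w : Ω × ℝ => Y w.2 w.1) (P.prod ν) := by
    have hm : Measurable fun w : Ω × ℝ => Y w.2 w.1 := hYm.comp measurable_swap
    refine (integrable_prod_iff' hm.aestronglyMeasurable).2
      ⟨ae_of_all _ fun t => (hY t).integrable (by norm_num), ?_⟩
    refine Integrable.of_bound
      hm.norm.stronglyMeasurable.integral_prod_left'.aestronglyMeasurable
      (1 + F.real univ) (ae_of_all _ fun t => ?_)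
    rw [Real.norm_of_nonneg (integral_nonneg fun _ => norm_nonneg _), ← hvar t]
    calc ∫ ω, ‖Y t ω‖ ∂P ≤ ∫ ω, (1 + Y t ω ^ 2) ∂P := by
          refine integral_mono ((hY t).integrable (by norm_num)).norm
            ((integrable_const _).add (hYsq t)) fun ω => ?_
          simp only [Real.norm_eq_abs]
          nlinarith [sq_abs (Y t ω), sq_nonneg (|Y t ω| - 1)]
      _ = 1 + ∫ ω, Y t ω ^ 2 ∂P := by
          rw [integral_add (integrable_const _) (hYsq t)]
          simp
  have hint2 : Integrable (fun w : Ω × (ℝ × ℝ) => Y w.2.1 w.1 * Y w.2.2 w.1)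
      (P.prod (ν.prod ν)) := by
    have hm : Measurable fun w : Ω × (ℝ × ℝ) => Y w.2.1 w.1 * Y w.2.2 w.1 :=
      (hYm.comp (measurable_snd.fst.prodMk measurable_fst)).mul
        (hYm.comp (measurable_snd.snd.prodMk measurable_fst))
    refine (integrable_prod_iff' hm.aestronglyMeasurable).2
      ⟨ae_of_all _ fun z => (hY z.1).integrable_mul (hY z.2), ?_⟩
    refine Integrable.of_bound
      hm.norm.stronglyMeasurable.integral_prod_left'.aestronglyMeasurable
      (F.real univ + F.real univ) (ae_of_all _ fun z => ?_)
    rw [Real.norm_of_nonneg (integral_nonneg fun _ => norm_nonneg _)]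
    nth_rw 1 [← hvar z.1]
    rw [← hvar z.2, ← integral_add (hYsq _) (hYsq _)]
    refine integral_mono ((hY z.1).integrable_mul (hY z.2)).norm
      ((hYsq _).add (hYsq _)) fun ω => ?_
    simp only [Real.norm_eq_abs, abs_mul]
    nlinarith [sq_abs (Y z.1 ω), sq_abs (Y z.2 ω), sq_nonneg (|Y z.1 ω| - |Y z.2 ω|)]
  let Z : Ω → ℝ := fun ω => ∫ t, Y t ω ∂ν
  have hZX : (fun ω => ∫ t, X t ω ∂ν) =ᵐ[P] Z := by
    filter_upwards [hXY] with ω h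
    simp only [h, Z]
  have hZsq : ∀ ω, Z ω ^ 2 = ∫ z : ℝ × ℝ, Y z.1 ω * Y z.2 ω ∂(ν.prod ν) := fun ω => by
    rw [integral_prod_mul (fun s => Y s ω) (fun t => Y t ω), pow_two]
  have hZ : MemLp Z 2 P := by
    refine (memLp_two_iff_integrable_sq hint1.integral_prod_left.aestronglyMeasurable).2 ?_
    exact hint2.integral_prod_left.congr (ae_of_all _ fun ω => (hZsq ω).symm)
  have hZmean : ∫ ω, Z ω ∂P = 0 := by
    have : ∫ ω, Z ω ∂P = ∫ t, ∫ ω, Y t ω ∂P ∂ν :=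
      integral_integral_swap (f := fun ω t => Y t ω) hint1
    rw [this]
    simp only [← integral_congr_ae (hXYt _), hmean, integral_zero]
  have hZvar : variance Z P = ∫ z : ℝ × ℝ, covFun X P z.1 z.2 ∂(ν.prod ν) := by
    rw [variance_eq_sub hZ, hZmean]
    simp only [Pi.pow_apply, hZsq]
    rw [integral_integral_swap (f := fun ω (z : ℝ × ℝ) => Y z.1 ω * Y z.2 ω) hint2]
    simp [hcov]
  have hcovint : Integrable (fun z : ℝ × ℝ => covFun X P z.1 z.2) (ν.prod ν) := by
    have := hint2.integral_prod_right
    simpa only [hcov] using this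
  refine ⟨?_, (memLp_congr_ae hZX).2 hZ, ?_, ?_⟩
  · filter_upwards [hcont] with ω h
    exact h.integrableOn_Icc
  · rw [variance_congr hZX, hZvar]
    exact integral_prod_symm _ hcovint
  · rw [variance_congr hZX, hZvar, hspec.integral_covFun_eq]
    exact integral_norm_charFun_sq_pos hacc hνae

end GaussianMinima

theorem proposition2p1 {Ω : Type*} [MeasurableSpace Ω] (P : Measure Ω) [IsProbabilityMeasure P]
    (X : ℝ → Ω → ℝ) (F : Measure ℝ)
    (hgauss : IsGaussianProcess X P)
    (hcentered : ∀ t : ℝ, ∫ ω, X t ω ∂P = 0)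
    (hcont : ∀ᵐ ω ∂P, Continuous (fun t => X t ω))
    (hstat : GaussianMinima.IsStationary X P)
    (hspec : GaussianMinima.IsSpectralMeasure X P F)
    (hS1 : GaussianMinima.HasExpMoments F)
    (hS2 : GaussianMinima.SupportHasAccPt F) :
    GaussianMinima.HasPowerExpansion (GaussianMinima.covFun X P) ∧
    (∀ a b : ℝ, a ≤ b → GaussianMinima.NonnegNondegenerateOn X P a b) ∧
    GaussianMinima.SmoothNondegenerate X P := by
  -- Gaussianity enters through finite second moments; the remaining argument is Hilbert-space
  -- theory.
  have hX : ∀ t, MemLp (X t) 2 P := fun t => (hgauss.hasGaussianLaw_eval t).memLp_two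
  exact ⟨hspec.hasPowerExpansion hS1,
    fun a b _ => GaussianMinima.nonnegNondegenerateOn hS2 hspec hX hcentered hcont a b,
    GaussianMinima.smoothNondegenerate hS1 hS2 hspec hX hcentered hcont⟩
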